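/- Let $(\Omega,\mathcal F,\mathbb P)$ be a probability space and $n,m\in\mathbb N$. Let $X_1,\dots,X_n$, $Y_1,\dots,Y_m$ (primary variables) and $\Theta_1,\dots,\Theta_n$, $\Delta_1,\dots,\Delta_m$ (weights) be real random variables; write $\overline F_i(x)=\mathbb P(X_i>x)$, $\overline G_j(y)=\mathbb P(Y_j>y)$, $F_i=1-\overline F_i$, $G_j=1-\overline G_j$, $Z^-=\max(-Z,0)$ and $x\wedge y=\min(x,y)$. Assume: 1. (Generalized tail asymptotic independence.) For all $1\le i\ne k\le n$ and $1\le j\le m$, $$\lim_{x_i\wedge x_k\wedge y_j\to\infty}\mathbb P\big(|X_i|>x_i \,\big|\, X_k>x_k,\ Y_j>y_j\big)=0,$$ and for all $1\le j\ne k\le m$ and $1\le i\le n$, $$\lim_{x_i\wedge y_j\wedge y_k\to\infty}\mathbb P\big(|Y_j|>y_j \,\big|\, X_i>x_i,\ Y_k>y_k\big)=0 .$$ 2. Each weight is almost surely non-negative, not almost surely equal to $0$, and almost surely bounded from above by a constant. The random vector $(\Theta_1,\dots,\Theta_n,\Delta_1,\dots,\Delta_m)$ is independent of $(X_1,\dots,X_n,Y_1,\dots,Y_m)$;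 the dependence among the weights is arbitrary. 3. For each $1\le i\le n\wedge m$, $X_i$ and $Y_i$ are strongly asymptotically independent with constant $C_i>0$: as $x\wedge y\to\infty$, $$\mathbb P(X_i^->x,\,Y_i>y)=O\big(F_i(-x)\overline G_i(y)\big),\qquad \mathbb P(X_i>x,\,Y_i^->y)=O\big(\overline F_i(x)G_i(-y)\big),$$ $$\mathbb P(X_i>x,\,Y_i>y)\sim C_i\,\overline F_i(x)\,\overline G_i(y).$$ For $1\le i\le n$, $1\le j\le m$ with $i\neq j$, $X_i$ and $Y_j$ are independent. 4. For $1\le i\le n$ and $1\le j\le m$, $F_i\in\mathcal R_{-\alpha_i}$ and $G_j\in\mathcal R_{-\alpha_j'}$ with $\alpha_i,\alpha_j'\in[0,\infty)$, where $V\in\mathcal R_{-\alpha}$ means that $\overline V(x)=1-V(x)>0$ for all $x>0$ and $\lim_{x\to\infty}\overline V(tx)/\overline V(x)=t^{-\alpha}$ for every $t>0$. Then, as $x\wedge y\to\infty$, $$\mathbb P\Big(\sum_{i=1}^n\Theta_iX_i>x,\ \sum_{j=1}^m\Delta_jY_j>y\Big)\sim\sum_{i=1}^n\ \sum_{\substack{1\le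 j\le m\\ j\ne i}}\mathbb E\big[\Theta_i^{\alpha_i}\Delta_j^{\alpha_j'}\big]\overline F_i(x)\overline G_j(y)+\sum_{i=1}^{n\wedge m}C_i\,\mathbb E\big[\Theta_i^{\alpha_i}\Delta_i^{\alpha_i'}\big]\overline F_i(x)\overline G_i(y).$$ Here powers of weights are read with the convention $0^0=0$, i.e. $\mathbb E[\Theta^{\alpha}\Delta^{\alpha'}]$ means $\mathbb E[\Theta^{\alpha}\Delta^{\alpha'}\mathbf 1_{\{\Theta>0,\,\Delta>0\}}]$ (this matters only if an exponent is $0$). The relation $f\sim g$ means $f-g=o(g)$; that is, $f/g\to1$ when $g$ is positive, and if $g$ is identically $0$ (every $\Theta_i\Delta_j=0$ almost surely), it means that $f(x,y)=0$ for all sufficiently large $x\wedge y$. -/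

import Mathlib

open MeasureTheory ProbabilityTheory Filter Topology Asymptotics

namespace WeightedSums

noncomputable section

variable {Ω : Type*} [MeasurableSpace Ω]

/-- The tail `x ↦ P(Z > x)` of (the distribution of) a real random variable `Z`. -/
def tail (μ : Measure Ω) (Z : Ω → ℝ) (x : ℝ) : ℝ := μ.real {ω | x < Z ω}

/-- The distribution function `x ↦ P(Z ≤ x)` of a real random variable `Z`. -/
def distr (μ : Measure Ω) (Z : Ω → ℝ) (x : ℝ) : ℝ := μ.real {ω | Z ω ≤ x}

/-- The distribution of `Z` belongs to the class `R_{-a}`: it has an infinite right endpoint and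
`P(Z > t x) / P(Z > x) → t ^ (-a)` as `x → ∞`, for every `t > 0`. -/
def RegVarying (μ : Measure Ω) (Z : Ω → ℝ) (a : ℝ) : Prop :=
  (∀ x : ℝ, 0 < x → 0 < tail μ Z x) ∧
    ∀ t : ℝ, 0 < t →
      Tendsto (fun x : ℝ => tail μ Z (t * x) / tail μ Z x) atTop (𝓝 (t ^ (-a)))

/-- `X` and `Y` are strongly asymptotically independent with constant `C`. The filter `atTop` on
`ℝ × ℝ` is the convergence `x ∧ y → ∞`. -/
structure SAI (μ : Measure Ω) (X Y : Ω → ℝ) (C : ℝ) : Prop where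
  pos : 0 < C
  neg_left :
    (fun p : ℝ × ℝ => μ.real {ω | p.1 < max (-(X ω)) 0 ∧ p.2 < Y ω}) =O[atTop]
      (fun p : ℝ × ℝ => distr μ X (-p.1) * tail μ Y p.2)
  neg_right :
    (fun p : ℝ × ℝ => μ.real {ω | p.1 < X ω ∧ p.2 < max (-(Y ω)) 0}) =O[atTop]
      (fun p : ℝ × ℝ => tail μ X p.1 * distr μ Y (-p.2))
  joint :
    (fun p : ℝ × ℝ => μ.real {ω | p.1 < X ω ∧ p.2 < Y ω}) ~[atTop]
      (fun p : ℝ × ℝ => C * (tail μ X p.1 * tail μ Y p.2))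

/-- `X 1, …, X n, Y 1, …, Y m` are generalized tail asymptotically independent. The filter `atTop`
on `ℝ × ℝ × ℝ` is the convergence of the minimum of the three coordinates to `∞`. -/
structure GTAI (μ : Measure Ω) (n m : ℕ) (X Y : ℕ → Ω → ℝ) : Prop where
  left : ∀ i ∈ Finset.Icc 1 n, ∀ k ∈ Finset.Icc 1 n, i ≠ k → ∀ j ∈ Finset.Icc 1 m,
    Tendsto (fun p : ℝ × ℝ × ℝ =>
        (cond μ {ω | p.2.1 < X k ω ∧ p.2.2 < Y j ω}).real {ω | p.1 < |X i ω|})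
      atTop (𝓝 0)
  right : ∀ j ∈ Finset.Icc 1 m, ∀ k ∈ Finset.Icc 1 m, j ≠ k → ∀ i ∈ Finset.Icc 1 n,
    Tendsto (fun p : ℝ × ℝ × ℝ =>
        (cond μ {ω | p.2.1 < X i ω ∧ p.2.2 < Y k ω}).real {ω | p.1 < |Y j ω|})
      atTop (𝓝 0)

/-- `W` is a random weight: a random variable that is almost surely non-negative, not almost surely
zero, and whose distribution has a support bounded from above. -/
structure IsWeight (μ : Measure Ω) (W : Ω → ℝ) : Prop where
  measurable : Measurable W
  nonneg : ∀ᵐ ω ∂μ, 0 ≤ W ω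
  nondegenerate : ¬ (∀ᵐ ω ∂μ, W ω = 0)
  bddAbove : ∃ b : ℝ, ∀ᵐ ω ∂μ, W ω ≤ b

/-- The mixed moment `E[Θ ^ a * Δ ^ b]` of two non-negative random variables, for `a, b ≥ 0`, with
the convention `0 ^ 0 = 0`: the integrand vanishes where `Θ = 0` or `Δ = 0`. (For positive exponents
this is the plain expectation.) -/
def mixedMoment (μ : Measure Ω) (Θ Δ : Ω → ℝ) (a b : ℝ) : ℝ :=
  ∫ ω in {ω | 0 < Θ ω ∧ 0 < Δ ω}, Θ ω ^ a * Δ ω ^ b ∂μ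

end

end WeightedSums

namespace WeightedSums

/-! Single big jump: both weighted sums are large essentially when exactly one term `Θ i * X i` and
exactly one term `Δ j * Y j` are large, so the joint tail is asymptotically the sum over pairs `(i,
j)` of the joint tails of the two terms.

Two estimates make this precise. For one pair, conditioning on the bounded independent weights
reduces the joint tail to that of `(X i, Y j)` at rescaled thresholds; regular variation and
dominated convergence then produce the mixed moment (`tendsto_weighted_jointTail`). The constant is
`C i` on the diagonal and, by independence, `1` off it. Tail asymptotic independence makes it
negligible that a third term is large as well (`tendsto_weighted_triple`).

For fixed `ε`, `measureReal_sums_le` and `le_measureReal_sums` trap the joint tail of the sums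
between sums over pairs at thresholds scaled by `1 - ε` and `1 + ε`, up to these negligible terms.
Letting `ε → 0` closes the gap, because the limits are continuous in the scaling factor
(`eventually_perturbed_bounds`). -/

/-! ### Deterministic single-big-jump estimates for finite sums. -/

/-- Some summand exceeds the average share. If every other one is at most `ε * x / N` in absolute
value, together they contribute at most `ε * x`, and this summand must supply the rest. -/
theorem exists_dominant_summand {ι : Type*} {I : Finset ι} {u : ι → ℝ} {x ε : ℝ}
    (hx : 0 < x) (hε : 0 < ε) (h : x < ∑ i ∈ I, u i) :
    ∃ i ∈ I, (I.card : ℝ)⁻¹ * x < u i ∧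
      ((1 - ε) * x < u i ∨ ∃ k ∈ I, k ≠ i ∧ ε * (I.card : ℝ)⁻¹ * x < |u k|) := by
  classical
  have hI : I.Nonempty := by
    rw [Finset.nonempty_iff_ne_empty]
    rintro rfl
    simp at h
    linarith
  have hN : (0 : ℝ) < I.card := by exact_mod_cast hI.card_pos
  obtain ⟨i, hi, hlt⟩ : ∃ i ∈ I, (I.card : ℝ)⁻¹ * x < u i := by
    refine Finset.exists_lt_of_sum_lt (f := fun _ => (I.card : ℝ)⁻¹ * x) ?_
    rw [Finset.sum_const, nsmul_eq_mul, ← mul_assoc, mul_inv_cancel₀ hN.ne', one_mul]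
    exact h
  refine ⟨i, hi, hlt, ?_⟩
  by_contra! hcon
  obtain ⟨h1, h2⟩ := hcon
  have h3 : ∑ k ∈ I.erase i, u k ≤ ∑ k ∈ I.erase i, ε * (I.card : ℝ)⁻¹ * x :=
    Finset.sum_le_sum fun k hk =>
      (le_abs_self _).trans (h2 k (Finset.mem_of_mem_erase hk) (Finset.ne_of_mem_erase hk))
  have h4 : ∑ k ∈ I.erase i, ε * (I.card : ℝ)⁻¹ * x ≤ ∑ k ∈ I, ε * (I.card : ℝ)⁻¹ * x :=
    Finset.sum_le_sum_of_subset_of_nonneg (Finset.erase_subset _ _) fun _ _ _ => by positivity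
  have h5 : ∑ k ∈ I, ε * (I.card : ℝ)⁻¹ * x = ε * x := by
    rw [Finset.sum_const, nsmul_eq_mul]
    field_simp
  have h6 := Finset.add_sum_erase I u hi
  linarith

theorem lt_sum_of_dominant {ι : Type*} {I : Finset ι} {u : ι → ℝ} {x ε : ℝ} {i : ι}
    (hx : 0 < x) (hε : 0 < ε) (hi : i ∈ I) (h : (1 + ε) * x < u i)
    (hk : ∀ k ∈ I, k ≠ i → |u k| ≤ ε * (I.card : ℝ)⁻¹ * x) : x < ∑ i ∈ I, u i := by
  classical
  have hN : (0 : ℝ) < I.card := by exact_mod_cast Finset.card_pos.2 ⟨i, hi⟩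
  have h3 : ∑ k ∈ I.erase i, -(ε * (I.card : ℝ)⁻¹ * x) ≤ ∑ k ∈ I.erase i, u k :=
    Finset.sum_le_sum fun k hk' =>
      neg_le_of_abs_le (hk k (Finset.mem_of_mem_erase hk') (Finset.ne_of_mem_erase hk'))
  have h4 : ∑ k ∈ I.erase i, ε * (I.card : ℝ)⁻¹ * x ≤ ∑ k ∈ I, ε * (I.card : ℝ)⁻¹ * x :=
    Finset.sum_le_sum_of_subset_of_nonneg (Finset.erase_subset _ _) fun _ _ _ => by positivity
  have h5 : ∑ k ∈ I, ε * (I.card : ℝ)⁻¹ * x = ε * x := by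
    rw [Finset.sum_const, nsmul_eq_mul]
    field_simp
  have h6 := Finset.add_sum_erase I u hi
  rw [Finset.sum_neg_distrib] at h3
  linarith

/-! ### Two-sided bounds for the joint tail of the sums by pairs of summands. -/

section Interference

variable {Ω ι κ : Type*} [DecidableEq ι] [DecidableEq κ]

/-- The event that `U i` and `V j` are large together with another summand of one of the sums. -/
def interferenceSet (I : Finset ι) (J : Finset κ) (U : ι → Ω → ℝ) (V : κ → Ω → ℝ) (ε : ℝ)
    (p : ℝ × ℝ) (q : ι × κ) : Set Ω :=
  (⋃ k ∈ I.erase q.1, {ω | ((I.card : ℝ)⁻¹ * p.1 < U q.1 ω ∧ (J.card : ℝ)⁻¹ * p.2 < V q.2 ω) ∧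
      ε * (I.card : ℝ)⁻¹ * p.1 < |U k ω|}) ∪
    ⋃ l ∈ J.erase q.2, {ω | ((I.card : ℝ)⁻¹ * p.1 < U q.1 ω ∧ (J.card : ℝ)⁻¹ * p.2 < V q.2 ω) ∧
      ε * (J.card : ℝ)⁻¹ * p.2 < |V l ω|}

variable {I : Finset ι} {J : Finset κ} {U : ι → Ω → ℝ} {V : κ → Ω → ℝ} {ε : ℝ} {p : ℝ × ℝ}

theorem mem_interferenceSet {q : ι × κ} {ω : Ω} :
    ω ∈ interferenceSet I J U V ε p q ↔
      ((I.card : ℝ)⁻¹ * p.1 < U q.1 ω ∧ (J.card : ℝ)⁻¹ * p.2 < V q.2 ω) ∧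
        ((∃ k ∈ I, k ≠ q.1 ∧ ε * (I.card : ℝ)⁻¹ * p.1 < |U k ω|) ∨
          ∃ l ∈ J, l ≠ q.2 ∧ ε * (J.card : ℝ)⁻¹ * p.2 < |V l ω|) := by
  simp only [interferenceSet, Set.mem_union, Set.mem_iUnion, Finset.mem_erase, Set.mem_ofPred_eq,
    exists_prop]
  grind

variable [MeasurableSpace Ω] {μ : Measure Ω}

/-- The union bound for the probability of `interferenceSet`. -/
noncomputable def interference (μ : Measure Ω) (I : Finset ι) (J : Finset κ) (U : ι → Ω → ℝ)
    (V : κ → Ω → ℝ) (q : ι × κ) (ε : ℝ) (p : ℝ × ℝ) : ℝ :=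
  (∑ k ∈ I.erase q.1,
      μ.real {ω | ((I.card : ℝ)⁻¹ * p.1 < U q.1 ω ∧ (J.card : ℝ)⁻¹ * p.2 < V q.2 ω) ∧
        ε * (I.card : ℝ)⁻¹ * p.1 < |U k ω|}) +
    ∑ l ∈ J.erase q.2,
      μ.real {ω | ((I.card : ℝ)⁻¹ * p.1 < U q.1 ω ∧ (J.card : ℝ)⁻¹ * p.2 < V q.2 ω) ∧
        ε * (J.card : ℝ)⁻¹ * p.2 < |V l ω|}

theorem measureReal_interferenceSet_le (q : ι × κ) :
    μ.real (interferenceSet I J U V ε p q) ≤ interference μ I J U V q ε p :=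
  (measureReal_union_le _ _).trans
    (add_le_add (measureReal_biUnion_finset_le _ _) (measureReal_biUnion_finset_le _ _))

/-- A summand above its average share is picked in each sum; either both dominate, or a further
summand is large and the interference event occurs. The union bound over pairs finishes. -/
theorem measureReal_sums_le [IsFiniteMeasure μ] (hp : 0 < p.1 ∧ 0 < p.2) (hε : 0 < ε) :
    μ.real {ω | p.1 < ∑ i ∈ I, U i ω ∧ p.2 < ∑ j ∈ J, V j ω} ≤
      ∑ q ∈ I ×ˢ J, (μ.real {ω | (1 - ε) * p.1 < U q.1 ω ∧ (1 - ε) * p.2 < V q.2 ω} +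
        interference μ I J U V q ε p) := by
  have hsub : {ω | p.1 < ∑ i ∈ I, U i ω ∧ p.2 < ∑ j ∈ J, V j ω} ⊆
      ⋃ q ∈ I ×ˢ J, ({ω | (1 - ε) * p.1 < U q.1 ω ∧ (1 - ε) * p.2 < V q.2 ω} ∪
        interferenceSet I J U V ε p q) := by
    rintro ω ⟨h1, h2⟩
    obtain ⟨i, hi, h3, h4⟩ := exists_dominant_summand hp.1 hε h1
    obtain ⟨j, hj, h5, h6⟩ := exists_dominant_summand hp.2 hε h2
    refine Set.mem_biUnion (x := (i, j)) (by simp [hi, hj]) ?_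
    rw [Set.mem_union, mem_interferenceSet, Set.mem_ofPred_eq]
    rcases h4 with h4 | h4
    · rcases h6 with h6 | h6
      · exact Or.inl ⟨h4, h6⟩
      · exact Or.inr ⟨⟨h3, h5⟩, Or.inr h6⟩
    · exact Or.inr ⟨⟨h3, h5⟩, Or.inl h4⟩
  refine (measureReal_mono hsub (measure_ne_top _ _)).trans ((measureReal_biUnion_finset_le _ _).trans
    (Finset.sum_le_sum fun q _ => (measureReal_union_le _ _).trans ?_))
  gcongr
  exact measureReal_interferenceSet_le q

/-- With interference removed, the events for different pairs are disjoint and each forces both sums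
to be large, so their probabilities add up to a lower bound. -/
theorem le_measureReal_sums [IsFiniteMeasure μ] (hU : ∀ i ∈ I, Measurable (U i))
    (hV : ∀ j ∈ J, Measurable (V j)) (hp : 0 < p.1 ∧ 0 < p.2) (hε : 0 < ε) :
    ∑ q ∈ I ×ˢ J, (μ.real {ω | (1 + ε) * p.1 < U q.1 ω ∧ (1 + ε) * p.2 < V q.2 ω} -
        interference μ I J U V q ε p) ≤
      μ.real {ω | p.1 < ∑ i ∈ I, U i ω ∧ p.2 < ∑ j ∈ J, V j ω} := by
  set E : ι × κ → Set Ω := fun q => {ω | (1 + ε) * p.1 < U q.1 ω ∧ (1 + ε) * p.2 < V q.2 ω} with hE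
  set G : ι × κ → Set Ω := fun q => E q \ interferenceSet I J U V ε p q with hG
  -- A summand above `(1 + ε) * x` passes both thresholds used in the interference event.
  have hinv : ∀ {N : ℕ} {x : ℝ}, 0 < x → (N : ℝ)⁻¹ * x < (1 + ε) * x ∧
      ε * (N : ℝ)⁻¹ * x < (1 + ε) * x := by
    intro N x hx
    have h1 : (N : ℝ)⁻¹ ≤ 1 := Nat.cast_inv_le_one N
    have h2 : ε * (N : ℝ)⁻¹ ≤ ε := mul_le_of_le_one_right hε.le h1
    constructor <;> nlinarith
  have mE : ∀ q ∈ I ×ˢ J, MeasurableSet (E q) := fun q hq =>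
    (measurableSet_lt measurable_const (hU _ (Finset.mem_product.1 hq).1)).inter
      (measurableSet_lt measurable_const (hV _ (Finset.mem_product.1 hq).2))
  have mB : ∀ q ∈ I ×ˢ J, MeasurableSet (interferenceSet I J U V ε p q) := by
    intro q hq
    have h1 := hU _ (Finset.mem_product.1 hq).1
    have h2 := hV _ (Finset.mem_product.1 hq).2
    have h3 : MeasurableSet {ω | (I.card : ℝ)⁻¹ * p.1 < U q.1 ω ∧ (J.card : ℝ)⁻¹ * p.2 < V q.2 ω} :=
      (measurableSet_lt measurable_const h1).inter (measurableSet_lt measurable_const h2)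
    refine (Finset.measurableSet_biUnion _ fun k hk => ?_).union
      (Finset.measurableSet_biUnion _ fun l hl => ?_)
    · exact h3.inter (measurableSet_lt measurable_const (hU k (Finset.mem_of_mem_erase hk)).norm)
    · exact h3.inter (measurableSet_lt measurable_const (hV l (Finset.mem_of_mem_erase hl)).norm)
  have hsub : (⋃ q ∈ I ×ˢ J, G q) ⊆ {ω | p.1 < ∑ i ∈ I, U i ω ∧ p.2 < ∑ j ∈ J, V j ω} := by
    refine Set.iUnion₂_subset fun q hq => ?_
    rintro ω ⟨⟨h1, h2⟩, h3⟩
    obtain ⟨hi, hj⟩ := Finset.mem_product.1 hq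
    rw [mem_interferenceSet] at h3
    have h4 : (I.card : ℝ)⁻¹ * p.1 < U q.1 ω ∧ (J.card : ℝ)⁻¹ * p.2 < V q.2 ω :=
      ⟨(hinv hp.1).1.trans h1, (hinv hp.2).1.trans h2⟩
    simp only [h4, not_or, true_and, not_exists, not_and, not_lt] at h3
    exact ⟨lt_sum_of_dominant hp.1 hε hi h1 (by simpa using h3.1),
      lt_sum_of_dominant hp.2 hε hj h2 (by simpa using h3.2)⟩
  -- Two distinct pairs differ in some coordinate; the large summand of `r` in that coordinate is
  -- interference for `q`.
  have hdisj : ((I ×ˢ J : Finset (ι × κ)) : Set (ι × κ)).PairwiseDisjoint G := by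
    intro q hq r hr hqr
    refine Set.disjoint_left.2 ?_
    rintro ω ⟨⟨h1, h2⟩, h3⟩ ⟨⟨h4, h5⟩, -⟩
    obtain ⟨hi, hj⟩ := Finset.mem_product.1 hr
    refine h3 (mem_interferenceSet.2
      ⟨⟨(hinv hp.1).1.trans h1, (hinv hp.2).1.trans h2⟩, ?_⟩)
    by_cases h : r.1 = q.1
    · exact Or.inr ⟨r.2, hj, fun h' => hqr (Prod.ext h.symm h'.symm),
        ((hinv hp.2).2.trans h5).trans_le (le_abs_self _)⟩
    · exact Or.inl ⟨r.1, hi, h, ((hinv hp.1).2.trans h4).trans_le (le_abs_self _)⟩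
  calc _ ≤ ∑ q ∈ I ×ˢ J, μ.real (G q) := by
        refine Finset.sum_le_sum fun q _ => ?_
        refine le_trans ?_ le_measureReal_sdiff
        exact sub_le_sub_left (measureReal_interferenceSet_le q) _
    _ = μ.real (⋃ q ∈ I ×ˢ J, G q) :=
        (measureReal_biUnion_finset hdisj fun q hq => (mE q hq).diff (mB q hq)).symm
    _ ≤ _ := measureReal_mono hsub

end Interference

variable {Ω : Type*} [MeasurableSpace Ω]

theorem IsWeight.exists_pos_bound {μ : Measure Ω} {W : Ω → ℝ} (h : IsWeight μ W) :
    ∃ b : ℝ, 0 < b ∧ ∀ᵐ ω ∂μ, 0 ≤ W ω ∧ W ω ≤ b := by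
  obtain ⟨b, hb⟩ := h.bddAbove
  refine ⟨max b 1, by positivity, ?_⟩
  filter_upwards [hb, h.nonneg] with ω h1 h2
  exact ⟨h2, h1.trans (le_max_left _ _)⟩

/-! ### Regular variation along rescaled thresholds. -/

theorem eventually_pos_prod : ∀ᶠ p : ℝ × ℝ in atTop, 0 < p.1 ∧ 0 < p.2 := by
  rw [← prod_atTop_atTop_eq]
  exact (eventually_gt_atTop 0).prod_mk (eventually_gt_atTop 0)

theorem tendsto_fst_prod_atTop : Tendsto (fun p : ℝ × ℝ => p.1) atTop atTop := by
  rw [← prod_atTop_atTop_eq]; exact tendsto_fst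

theorem tendsto_snd_prod_atTop : Tendsto (fun p : ℝ × ℝ => p.2) atTop atTop := by
  rw [← prod_atTop_atTop_eq]; exact tendsto_snd

theorem tendsto_scale_prod {s t : ℝ} (hs : 0 < s) (ht : 0 < t) :
    Tendsto (fun p : ℝ × ℝ => (s * p.1, t * p.2)) atTop atTop := by
  conv_rhs => rw [← prod_atTop_atTop_eq]
  exact (tendsto_fst_prod_atTop.const_mul_atTop hs).prodMk
    (tendsto_snd_prod_atTop.const_mul_atTop ht)

/-- The product `P(X > x) P(Y > y)` is eventually positive for regularly varying tails. -/
theorem eventually_tail_mul_pos {μ : Measure Ω} {X Y : Ω → ℝ} {a a' : ℝ}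
    (hX : RegVarying μ X a) (hY : RegVarying μ Y a') :
    ∀ᶠ p : ℝ × ℝ in atTop, 0 < tail μ X p.1 * tail μ Y p.2 := by
  filter_upwards [eventually_pos_prod] with p hp
  exact mul_pos (hX.1 _ hp.1) (hY.1 _ hp.2)

theorem tendsto_tail_mul_ratio {μ : Measure Ω} {X Y : Ω → ℝ} {a a' s t : ℝ}
    (hX : RegVarying μ X a) (hY : RegVarying μ Y a') (hs : 0 < s) (ht : 0 < t) :
    Tendsto (fun p : ℝ × ℝ => tail μ X (s * p.1) * tail μ Y (t * p.2) /
      (tail μ X p.1 * tail μ Y p.2)) atTop (𝓝 (s ^ (-a) * t ^ (-a'))) := by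
  have := ((hX.2 s hs).comp tendsto_fst_prod_atTop).mul ((hY.2 t ht).comp tendsto_snd_prod_atTop)
  refine this.congr fun p => ?_
  simp [mul_div_mul_comm]

/-- Asymptotics of a joint tail along rescaled thresholds. -/
theorem tendsto_jointTail_scale {μ : Measure Ω} {X Y : Ω → ℝ} {a a' C s t : ℝ}
    (hX : RegVarying μ X a) (hY : RegVarying μ Y a')
    (hJ : (fun p : ℝ × ℝ => μ.real {ω | p.1 < X ω ∧ p.2 < Y ω}) ~[atTop]
      (fun p : ℝ × ℝ => C * (tail μ X p.1 * tail μ Y p.2)))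
    (hs : 0 < s) (ht : 0 < t) :
    Tendsto (fun p : ℝ × ℝ => μ.real {ω | s * p.1 < X ω ∧ t * p.2 < Y ω} /
      (tail μ X p.1 * tail μ Y p.2)) atTop (𝓝 (C * (s ^ (-a) * t ^ (-a')))) := by
  obtain ⟨φ, hφ, h⟩ := hJ.exists_eq_mul
  have h1 := (tendsto_scale_prod hs ht).eventually h
  have h2 := ((hφ.comp (tendsto_scale_prod hs ht)).mul_const C).mul
    (tendsto_tail_mul_ratio hX hY hs ht)
  rw [one_mul] at h2
  refine h2.congr' ?_
  filter_upwards [h1] with p hp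
  simp only [Pi.mul_apply] at hp
  rw [hp]
  simp only [Function.comp]
  ring

/-! ### Joint tails with random weights. -/

/-- Conditioning on independent weights. -/
theorem measureReal_weighted_eq_integral {μ : Measure Ω} [IsProbabilityMeasure μ]
    {A B X Y : Ω → ℝ} (hA : Measurable A) (hB : Measurable B) (hX : Measurable X)
    (hY : Measurable Y) (hind : IndepFun (fun ω => (A ω, B ω)) (fun ω => (X ω, Y ω)) μ)
    (p : ℝ × ℝ) :
    Measurable (fun ω => μ.real {ω' | p.1 < A ω * X ω' ∧ p.2 < B ω * Y ω'}) ∧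
    μ.real {ω | p.1 < A ω * X ω ∧ p.2 < B ω * Y ω} =
      ∫ ω, μ.real {ω' | p.1 < A ω * X ω' ∧ p.2 < B ω * Y ω'} ∂μ := by
  set V : Ω → ℝ × ℝ := fun ω => (A ω, B ω) with hV
  set W : Ω → ℝ × ℝ := fun ω => (X ω, Y ω) with hW
  have mV : Measurable V := hA.prodMk hB
  have mW : Measurable W := hX.prodMk hY
  set S : Set ((ℝ × ℝ) × (ℝ × ℝ)) := {q | p.1 < q.1.1 * q.2.1 ∧ p.2 < q.1.2 * q.2.2} with hS
  have mS : MeasurableSet S := by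
    have m1 : Measurable fun q : (ℝ × ℝ) × (ℝ × ℝ) => q.1.1 * q.2.1 := by fun_prop
    have m2 : Measurable fun q : (ℝ × ℝ) × (ℝ × ℝ) => q.1.2 * q.2.2 := by fun_prop
    exact (measurableSet_lt measurable_const m1).inter (measurableSet_lt measurable_const m2)
  have mF : Measurable fun v => μ.map W (Prod.mk v ⁻¹' S) := measurable_measure_prodMk_left mS
  have hF : ∀ ω, μ.real {ω' | p.1 < A ω * X ω' ∧ p.2 < B ω * Y ω'} =
      (μ.map W (Prod.mk (V ω) ⁻¹' S)).toReal := by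
    intro ω
    rw [Measure.map_apply mW (measurable_prodMk_left mS)]
    rfl
  have : IsProbabilityMeasure (μ.map W) := Measure.isProbabilityMeasure_map mW.aemeasurable
  have : IsProbabilityMeasure (μ.map V) := Measure.isProbabilityMeasure_map mV.aemeasurable
  constructor
  · simp_rw [hF]
    exact (mF.comp mV).ennreal_toReal
  · simp_rw [hF]
    have h2 := integral_toReal (mF.comp mV).aemeasurable
      (ae_of_all μ fun ω => measure_lt_top (μ.map W) (Prod.mk (V ω) ⁻¹' S))
    simp only [Function.comp] at h2
    rw [h2]
    have h1 : μ {ω | p.1 < A ω * X ω ∧ p.2 < B ω * Y ω} =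
        μ.map (fun ω => (V ω, W ω)) S := by
      rw [Measure.map_apply (mV.prodMk mW) mS]
      rfl
    rw [Measure.real, h1, (indepFun_iff_map_prod_eq_prod_map_map mV.aemeasurable
      mW.aemeasurable).1 hind, Measure.prod_apply mS, lintegral_map mF mV]

/-- A two-dimensional Breiman lemma for bounded weights. -/
theorem tendsto_weighted_jointTail {μ : Measure Ω} [IsProbabilityMeasure μ]
    {A B X Y : Ω → ℝ} {a a' C : ℝ} (hA : IsWeight μ A) (hB : IsWeight μ B) (mX : Measurable X)
    (mY : Measurable Y) (hind : IndepFun (fun ω => (A ω, B ω)) (fun ω => (X ω, Y ω)) μ)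
    (hX : RegVarying μ X a) (hY : RegVarying μ Y a')
    (hJ : (fun p : ℝ × ℝ => μ.real {ω | p.1 < X ω ∧ p.2 < Y ω}) ~[atTop]
      (fun p : ℝ × ℝ => C * (tail μ X p.1 * tail μ Y p.2))) :
    Tendsto (fun p : ℝ × ℝ => μ.real {ω | p.1 < A ω * X ω ∧ p.2 < B ω * Y ω} /
      (tail μ X p.1 * tail μ Y p.2)) atTop (𝓝 (C * mixedMoment μ A B a a')) := by
  obtain ⟨b, hb, hAb⟩ := hA.exists_pos_bound
  obtain ⟨c, hc, hBc⟩ := hB.exists_pos_bound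
  set E : Set Ω := {ω | 0 < A ω ∧ 0 < B ω} with hE
  have mE : MeasurableSet E :=
    (measurableSet_lt measurable_const hA.measurable).inter
      (measurableSet_lt measurable_const hB.measurable)
  -- The indicator encodes the convention `0 ^ 0 = 0`: where a weight vanishes, the integrand is
  -- zero for positive thresholds.
  have hlim : C * mixedMoment μ A B a a' =
      ∫ ω, E.indicator (fun ω => C * (A ω ^ a * B ω ^ a')) ω ∂μ := by
    rw [integral_indicator mE, integral_const_mul]
    rfl
  have hint := fun p => measureReal_weighted_eq_integral hA.measurable hB.measurable mX mY hind p
  have hfun : ∀ p : ℝ × ℝ, μ.real {ω | p.1 < A ω * X ω ∧ p.2 < B ω * Y ω} /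
      (tail μ X p.1 * tail μ Y p.2) =
      ∫ ω, μ.real {ω' | p.1 < A ω * X ω' ∧ p.2 < B ω * Y ω'} /
        (tail μ X p.1 * tail μ Y p.2) ∂μ := by
    intro p
    rw [integral_div, ← (hint p).2]
  rw [hlim]
  simp_rw [hfun]
  -- Replacing the weights by their bounds `b` and `c` only enlarges the event, so this convergent
  -- ratio eventually gives a constant dominating function.
  have hbnd := (tendsto_jointTail_scale hX hY hJ (inv_pos.2 hb) (inv_pos.2 hc)).eventually_lt_const
    (lt_add_one _)
  refine tendsto_integral_filter_of_dominated_convergence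
    (fun _ => C * (b⁻¹ ^ (-a) * c⁻¹ ^ (-a')) + 1)
    (Eventually.of_forall fun p => ((hint p).1.div_const _).aestronglyMeasurable) ?_
    (integrable_const _) ?_
  · filter_upwards [hbnd, eventually_pos_prod, eventually_tail_mul_pos hX hY] with p h1 h2 h3
    filter_upwards [hAb, hBc] with ω hω1 hω2
    rw [Real.norm_of_nonneg (by positivity)]
    refine le_trans ?_ h1.le
    refine div_le_div_of_nonneg_right ?_ h3.le
    refine measureReal_mono (μ := μ) (s₂ := {ω | b⁻¹ * p.1 < X ω ∧ c⁻¹ * p.2 < Y ω}) ?_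
    rintro ω' ⟨h4, h5⟩
    have aux : ∀ {u v w x : ℝ}, 0 < w → 0 ≤ u → u ≤ v → 0 < v → w < u * x → v⁻¹ * w < x := by
      intro u v w x hw hu huv hv h
      have hx : 0 < x := by
        by_contra hx
        nlinarith [mul_nonneg hu (neg_nonneg.2 (not_lt.1 hx))]
      rw [inv_mul_lt_iff₀ hv]
      nlinarith
    exact ⟨aux h2.1 hω1.1 hω1.2 hb h4, aux h2.2 hω2.1 hω2.2 hc h5⟩
  · filter_upwards [hAb, hBc] with ω hω1 hω2
    by_cases hω : ω ∈ E
    · rw [Set.indicator_of_mem hω]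
      have := tendsto_jointTail_scale hX hY hJ (inv_pos.2 hω.1) (inv_pos.2 hω.2)
      rw [Real.rpow_neg_eq_inv_rpow, Real.rpow_neg_eq_inv_rpow, inv_inv, inv_inv] at this
      refine this.congr fun p => ?_
      simp only [inv_mul_lt_iff₀ hω.1, inv_mul_lt_iff₀ hω.2]
    · rw [Set.indicator_of_notMem hω]
      refine tendsto_const_nhds.congr' ?_
      filter_upwards [eventually_pos_prod] with p hp
      have : {ω' | p.1 < A ω * X ω' ∧ p.2 < B ω * Y ω'} = ∅ := by
        ext ω'
        simp only [Set.mem_ofPred_eq, Set.mem_empty_iff_false, iff_false, not_and]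
        intro h1 h2
        refine hω ⟨lt_of_le_of_ne hω1.1 fun h => ?_, lt_of_le_of_ne hω2.1 fun h => ?_⟩
        · rw [← h, zero_mul] at h1; exact absurd h1 hp.1.not_gt
        · rw [← h, zero_mul] at h2; exact absurd h2 hp.2.not_gt
      simp [this]

theorem mixedMoment_nonneg (μ : Measure Ω) {A B : Ω → ℝ} (hA : Measurable A) (hB : Measurable B)
    (a a' : ℝ) : 0 ≤ mixedMoment μ A B a a' := by
  refine setIntegral_nonneg ((measurableSet_lt measurable_const hA).inter
      (measurableSet_lt measurable_const hB)) fun ω hω => ?_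
  exact mul_nonneg (Real.rpow_nonneg hω.1.le _) (Real.rpow_nonneg hω.2.le _)

/-- If the mixed moment vanishes, the two weights are almost surely never both positive. -/
theorem measure_pos_pos_eq_zero {μ : Measure Ω} [IsProbabilityMeasure μ] {A B : Ω → ℝ} {a a' : ℝ}
    (hA : IsWeight μ A) (hB : IsWeight μ B) (ha : 0 ≤ a) (ha' : 0 ≤ a')
    (h : mixedMoment μ A B a a' = 0) : ∀ᵐ ω ∂μ, ¬ (0 < A ω ∧ 0 < B ω) := by
  set E : Set Ω := {ω | 0 < A ω ∧ 0 < B ω} with hE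
  have mE : MeasurableSet E :=
    (measurableSet_lt measurable_const hA.measurable).inter
      (measurableSet_lt measurable_const hB.measurable)
  obtain ⟨b, hb, hAb⟩ := hA.exists_pos_bound
  obtain ⟨c, hc, hBc⟩ := hB.exists_pos_bound
  have hint : IntegrableOn (fun ω => A ω ^ a * B ω ^ a') E μ := by
    refine Integrable.integrableOn (Integrable.of_bound (C := b ^ a * c ^ a')
      ((hA.measurable.pow_const a).mul (hB.measurable.pow_const a')).aestronglyMeasurable ?_)
    filter_upwards [hAb, hBc] with ω h1 h2
    rw [Real.norm_of_nonneg (mul_nonneg (Real.rpow_nonneg h1.1 _) (Real.rpow_nonneg h2.1 _))]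
    exact mul_le_mul (Real.rpow_le_rpow h1.1 h1.2 ha) (Real.rpow_le_rpow h2.1 h2.2 ha')
      (Real.rpow_nonneg h2.1 _) (by positivity)
  have hnn : 0 ≤ᵐ[μ.restrict E] fun ω => A ω ^ a * B ω ^ a' := by
    filter_upwards [ae_restrict_mem mE] with ω hω
    exact mul_nonneg (Real.rpow_nonneg hω.1.le _) (Real.rpow_nonneg hω.2.le _)
  -- The integrand is strictly positive on `E`, so a zero integral leaves only a null set.
  have h0 : μ ((Function.support fun ω => A ω ^ a * B ω ^ a') ∩ E) = 0 := by
    by_contra hne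
    exact ((setIntegral_pos_iff_support_of_nonneg_ae hnn hint).2 (pos_iff_ne_zero.2 hne)).ne' h
  refine measure_mono_null ?_ h0
  intro ω hω
  have hω' : 0 < A ω ∧ 0 < B ω := not_not.1 hω
  exact ⟨(mul_pos (Real.rpow_pos_of_pos hω'.1 _) (Real.rpow_pos_of_pos hω'.2 _)).ne', hω'⟩

/-- Weighted joint tails vanish for positive thresholds when the weights are almost surely never
both positive. -/
theorem measureReal_weighted_eq_zero {μ : Measure Ω} {A B X Y : Ω → ℝ}
    (hA : IsWeight μ A) (hB : IsWeight μ B) (h : ∀ᵐ ω ∂μ, ¬ (0 < A ω ∧ 0 < B ω))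
    {x y : ℝ} (hx : 0 < x) (hy : 0 < y) :
    μ.real {ω | x < A ω * X ω ∧ y < B ω * Y ω} = 0 := by
  have : μ {ω | x < A ω * X ω ∧ y < B ω * Y ω} = 0 := by
    have : ∀ᵐ ω ∂μ, ¬ (x < A ω * X ω ∧ y < B ω * Y ω) := by
      filter_upwards [h, hA.nonneg, hB.nonneg] with ω h1 h2 h3
      rintro ⟨h4, h5⟩
      refine h1 ⟨lt_of_le_of_ne h2 fun h => ?_, lt_of_le_of_ne h3 fun h => ?_⟩
      · rw [← h, zero_mul] at h4; exact absurd h4 hx.not_gt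
      · rw [← h, zero_mul] at h5; exact absurd h5 hy.not_gt
    rw [ae_iff] at this
    simpa using this
  simp [Measure.real, this]

/-- The probability that a third variable is large along with two weighted ones is negligible. -/
theorem tendsto_weighted_triple {μ : Measure Ω} [IsProbabilityMeasure μ]
    {A B D X Y Z : Ω → ℝ} {a a' C s t : ℝ} (hA : IsWeight μ A) (hB : IsWeight μ B)
    (hD : IsWeight μ D) (mX : Measurable X) (mY : Measurable Y)
    (hX : RegVarying μ X a) (hY : RegVarying μ Y a')
    (hJ : (fun p : ℝ × ℝ => μ.real {ω | p.1 < X ω ∧ p.2 < Y ω}) ~[atTop]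
      (fun p : ℝ × ℝ => C * (tail μ X p.1 * tail μ Y p.2)))
    (hZ : Tendsto (fun p : ℝ × ℝ × ℝ =>
        (cond μ {ω | p.2.1 < X ω ∧ p.2.2 < Y ω}).real {ω | p.1 < |Z ω|}) atTop (𝓝 0))
    (hs : 0 < s) (ht : 0 < t) {w : ℝ × ℝ → ℝ} (hw : Tendsto w atTop atTop) :
    Tendsto (fun p : ℝ × ℝ => μ.real {ω | (s * p.1 < A ω * X ω ∧ t * p.2 < B ω * Y ω) ∧
      w p < |D ω * Z ω|} / (tail μ X p.1 * tail μ Y p.2)) atTop (𝓝 0) := by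
  obtain ⟨b, hb, hAb⟩ := hA.exists_pos_bound
  obtain ⟨c, hc, hBc⟩ := hB.exists_pos_bound
  obtain ⟨d, hd, hDd⟩ := hD.exists_pos_bound
  have hs' : 0 < s / b := by positivity
  have ht' : 0 < t / c := by positivity
  have h1 : Tendsto (fun p : ℝ × ℝ => (w p / d, (s / b) * p.1, (t / c) * p.2)) atTop atTop := by
    conv_rhs => rw [← prod_atTop_atTop_eq]
    exact (hw.atTop_div_const hd).prodMk (tendsto_scale_prod hs' ht')
  -- Bounding the weights removes them; the triple probability is then at most a conditional
  -- probability tending to `0` times a joint tail of the order of the product of tails.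
  have h2 := (hZ.comp h1).mul (tendsto_jointTail_scale hX hY hJ hs' ht')
  rw [zero_mul] at h2
  refine squeeze_zero' (Eventually.of_forall fun p => ?_) ?_ h2
  · exact div_nonneg measureReal_nonneg (mul_nonneg measureReal_nonneg measureReal_nonneg)
  · filter_upwards [eventually_pos_prod] with p hp
    rw [← mul_div_assoc]
    refine div_le_div_of_nonneg_right ?_ (mul_nonneg measureReal_nonneg measureReal_nonneg)
    set S : Set Ω := {ω | (s / b) * p.1 < X ω ∧ (t / c) * p.2 < Y ω} with hS
    have mS : MeasurableSet S :=
      (measurableSet_lt measurable_const mX).inter (measurableSet_lt measurable_const mY)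
    have h3 : (cond μ S).real {ω | w p / d < |Z ω|} * μ.real S =
        μ.real (S ∩ {ω | w p / d < |Z ω|}) := by
      simp only [Measure.real]
      rw [← ENNReal.toReal_mul, cond_mul_eq_inter mS]
    simp only [Function.comp]
    rw [h3]
    refine ENNReal.toReal_mono (measure_ne_top _ _) (measure_mono_ae ?_)
    filter_upwards [hAb, hBc, hDd] with ω hω1 hω2 hω3
    rintro ⟨⟨h4, h5⟩, h6⟩
    have aux : ∀ {u v r q x : ℝ}, 0 < r → 0 < q → 0 ≤ u → u ≤ v → 0 < v → r * q < u * x →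
        r / v * q < x := by
      intro u v r q x hr hq hu huv hv h
      have hrq := mul_pos hr hq
      have hx : 0 < x := by
        by_contra hx
        nlinarith [mul_nonneg hu (neg_nonneg.2 (not_lt.1 hx))]
      rw [div_mul_eq_mul_div, div_lt_iff₀ hv]
      nlinarith
    refine ⟨⟨aux hs hp.1 hω1.1 hω1.2 hb h4, aux ht hp.2 hω2.1 hω2.2 hc h5⟩, ?_⟩
    change w p / d < |Z ω|
    rw [div_lt_iff₀ hd]
    refine lt_of_lt_of_le h6 ?_
    rw [abs_mul, abs_of_nonneg hω3.1, mul_comm]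
    exact mul_le_mul_of_nonneg_left hω3.2 (abs_nonneg _)

/-- Sandwich of a perturbed joint tail by multiples of its limit. -/
theorem eventually_perturbed_bounds {μ : Measure Ω} {X Y : Ω → ℝ} {a a' c : ℝ}
    (hX : RegVarying μ X a) (hY : RegVarying μ Y a') (hc : 0 ≤ c)
    {h : ℝ × ℝ → ℝ} {R : ℝ → ℝ × ℝ → ℝ}
    (hh : Tendsto (fun p => h p / (tail μ X p.1 * tail μ Y p.2)) atTop (𝓝 c))
    (hh0 : c = 0 → ∀ᶠ p in atTop, h p = 0)
    (hR : ∀ ε : ℝ, 0 < ε →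
      Tendsto (fun p => R ε p / (tail μ X p.1 * tail μ Y p.2)) atTop (𝓝 0))
    (hR0 : c = 0 → ∀ ε : ℝ, 0 < ε → ∀ᶠ p in atTop, R ε p = 0)
    {η : ℝ} (hη : 0 < η) :
    ∀ᶠ ε : ℝ in 𝓝[>] 0, ∀ᶠ p : ℝ × ℝ in atTop,
      h ((1 - ε) * p.1, (1 - ε) * p.2) + R ε p ≤
          (1 + η) * (c * (tail μ X p.1 * tail μ Y p.2)) ∧
        (1 - η) * (c * (tail μ X p.1 * tail μ Y p.2)) ≤
          h ((1 + ε) * p.1, (1 + ε) * p.2) - R ε p := by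
  have hε1 : ∀ᶠ ε : ℝ in 𝓝[>] 0, 0 < ε ∧ ε < 1 :=
    (eventually_mem_nhdsWithin).and (mem_nhdsWithin_of_mem_nhds (Iio_mem_nhds one_pos))
  have hsc : ∀ r : ℝ, 0 < r → Tendsto (fun p : ℝ × ℝ => h (r * p.1, r * p.2) /
      (tail μ X p.1 * tail μ Y p.2)) atTop (𝓝 (c * (r ^ (-a) * r ^ (-a')))) := by
    intro r hr
    refine ((hh.comp (tendsto_scale_prod hr hr)).mul
      (tendsto_tail_mul_ratio hX hY hr hr)).congr' ?_
    filter_upwards [(tendsto_scale_prod hr hr).eventually (eventually_tail_mul_pos hX hY)]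
      with p hp
    simp only [Function.comp]
    exact div_mul_div_cancel₀ hp.ne'
  -- A zero limit leaves no slack: both bounds become comparisons with `0`, so exact vanishing is
  -- used instead of convergence.
  rcases hc.eq_or_lt with rfl | hc
  · filter_upwards [hε1] with ε hε
    filter_upwards [hR0 rfl ε hε.1,
      (tendsto_scale_prod (sub_pos.2 hε.2) (sub_pos.2 hε.2)).eventually (hh0 rfl),
      (tendsto_scale_prod (by linarith [hε.1] : 0 < 1 + ε)
        (by linarith [hε.1] : 0 < 1 + ε)).eventually (hh0 rfl)] with p h1 h2 h3
    rw [h1, h2, h3]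
    simp
  -- For `c > 0`, continuity at `r = 1` keeps the effect of the factors `1 ± ε` within `η` once `ε`
  -- is small.
  · have hcont : ContinuousAt (fun r : ℝ => c * (r ^ (-a) * r ^ (-a'))) 1 := by
      refine continuousAt_const.mul ((Real.continuousAt_rpow_const _ _ (Or.inl one_ne_zero)).mul
        (Real.continuousAt_rpow_const _ _ (Or.inl one_ne_zero)))
    have hlim : Tendsto (fun r : ℝ => c * (r ^ (-a) * r ^ (-a'))) (𝓝 1) (𝓝 c) := by
      simpa [ContinuousAt] using hcont
    have hm : Tendsto (fun ε : ℝ => 1 - ε) (𝓝[>] 0) (𝓝 1) := by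
      refine Tendsto.mono_left ?_ nhdsWithin_le_nhds
      exact Continuous.tendsto' (by fun_prop) _ _ (by simp)
    have hp : Tendsto (fun ε : ℝ => 1 + ε) (𝓝[>] 0) (𝓝 1) := by
      refine Tendsto.mono_left ?_ nhdsWithin_le_nhds
      exact Continuous.tendsto' (by fun_prop) _ _ (by simp)
    filter_upwards [hε1,
      (hlim.comp hm).eventually_lt_const (show c < (1 + η) * c by nlinarith),
      (hlim.comp hp).eventually_const_lt (show (1 - η) * c < c by nlinarith)] with ε hε h1 h2
    have l1 := (hsc _ (sub_pos.2 hε.2)).add (hR ε hε.1)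
    have l2 := (hsc _ (by linarith [hε.1] : 0 < 1 + ε)).sub (hR ε hε.1)
    rw [add_zero] at l1
    rw [sub_zero] at l2
    filter_upwards [eventually_tail_mul_pos hX hY, l1.eventually_lt_const h1,
      l2.eventually_const_lt h2] with p hp h3 h4
    rw [← add_div, div_lt_iff₀ hp] at h3
    rw [← sub_div, lt_div_iff₀ hp] at h4
    constructor <;> nlinarith

end WeightedSums

/-! ### Assembly over all pairs. -/

theorem mainTheorem2 {Ω : Type*} [MeasurableSpace Ω] (μ : Measure Ω) [IsProbabilityMeasure μ]
    (n m : ℕ) (X Y Θ Δ : ℕ → Ω → ℝ) (C α α' : ℕ → ℝ)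
    (hX : ∀ i ∈ Finset.Icc 1 n, Measurable (X i))
    (hY : ∀ j ∈ Finset.Icc 1 m, Measurable (Y j))
    (hGTAI : WeightedSums.GTAI μ n m X Y)
    (hΘ : ∀ i ∈ Finset.Icc 1 n, WeightedSums.IsWeight μ (Θ i))
    (hΔ : ∀ j ∈ Finset.Icc 1 m, WeightedSums.IsWeight μ (Δ j))
    (hindep : IndepFun
      (fun ω => ((fun i : Finset.Icc 1 n => Θ i ω), (fun j : Finset.Icc 1 m => Δ j ω)))
      (fun ω => ((fun i : Finset.Icc 1 n => X i ω), (fun j : Finset.Icc 1 m => Y j ω))) μ)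
    (hSAI : ∀ i ∈ Finset.Icc 1 (min n m), WeightedSums.SAI μ (X i) (Y i) (C i))
    (hXY : ∀ i ∈ Finset.Icc 1 n, ∀ j ∈ Finset.Icc 1 m, i ≠ j → IndepFun (X i) (Y j) μ)
    (hα : ∀ i ∈ Finset.Icc 1 n, 0 ≤ α i)
    (hα' : ∀ j ∈ Finset.Icc 1 m, 0 ≤ α' j)
    (hF : ∀ i ∈ Finset.Icc 1 n, WeightedSums.RegVarying μ (X i) (α i))
    (hG : ∀ j ∈ Finset.Icc 1 m, WeightedSums.RegVarying μ (Y j) (α' j)) :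
    (fun p : ℝ × ℝ =>
        μ.real {ω | p.1 < ∑ i ∈ Finset.Icc 1 n, Θ i ω * X i ω ∧
          p.2 < ∑ j ∈ Finset.Icc 1 m, Δ j ω * Y j ω})
      ~[atTop]
    (fun p : ℝ × ℝ =>
      (∑ i ∈ Finset.Icc 1 n, ∑ j ∈ (Finset.Icc 1 m).filter (fun j => j ≠ i),
        WeightedSums.mixedMoment μ (Θ i) (Δ j) (α i) (α' j) *
          WeightedSums.tail μ (X i) p.1 * WeightedSums.tail μ (Y j) p.2) +
      ∑ i ∈ Finset.Icc 1 (min n m),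
        C i * WeightedSums.mixedMoment μ (Θ i) (Δ i) (α i) (α' i) *
          WeightedSums.tail μ (X i) p.1 * WeightedSums.tail μ (Y i) p.2) := by
  open WeightedSums in
  set I := Finset.Icc 1 n with hI
  set J := Finset.Icc 1 m with hJ
  -- One constant per pair merges the diagonal and off-diagonal sums into a single sum over `I ×ˢ
  -- J`.
  set K : ℕ × ℕ → ℝ := fun q => if q.1 = q.2 then C q.1 else 1 with hK
  set M : ℕ × ℕ → ℝ := fun q => mixedMoment μ (Θ q.1) (Δ q.2) (α q.1) (α' q.2) with hM
  set U : ℕ → Ω → ℝ := fun i ω => Θ i ω * X i ω with hU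
  set V : ℕ → Ω → ℝ := fun j ω => Δ j ω * Y j ω with hV
  have hdiag : ∀ i, i ∈ I → i ∈ J → i ∈ Finset.Icc 1 (min n m) := by
    intro i h1 h2
    rw [hI, Finset.mem_Icc] at h1
    rw [hJ, Finset.mem_Icc] at h2
    exact Finset.mem_Icc.2 ⟨h1.1, le_min h1.2 h2.2⟩
  have hsum : ∀ p : ℝ × ℝ,
      (∑ i ∈ I, ∑ j ∈ J.filter (fun j => j ≠ i),
        mixedMoment μ (Θ i) (Δ j) (α i) (α' j) * tail μ (X i) p.1 * tail μ (Y j) p.2) +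
      ∑ i ∈ Finset.Icc 1 (min n m),
        C i * mixedMoment μ (Θ i) (Δ i) (α i) (α' i) * tail μ (X i) p.1 * tail μ (Y i) p.2 =
      ∑ q ∈ I ×ˢ J, K q * M q * (tail μ (X q.1) p.1 * tail μ (Y q.2) p.2) := by
    intro p
    have hmin : Finset.Icc 1 (min n m) = I.filter (fun i => i ∈ J) := by
      ext i
      simp only [hI, hJ, Finset.mem_filter, Finset.mem_Icc, le_min_iff]
      tauto
    rw [Finset.sum_product, hmin, Finset.sum_filter, ← Finset.sum_add_distrib]
    refine Finset.sum_congr rfl fun i _ => ?_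
    rw [← Finset.sum_filter_add_sum_filter_not J (fun j => j ≠ i)]
    congr 1
    · refine Finset.sum_congr rfl fun j hj => ?_
      simp only [hK, if_neg (Finset.mem_filter.1 hj).2.symm, hM]
      ring
    · simp only [not_not, Finset.filter_eq']
      split_ifs with h
      · simp [hK, hM, mul_assoc]
      · simp
  simp_rw [hsum]
  have hJoint : ∀ q ∈ I ×ˢ J,
      (fun p : ℝ × ℝ => μ.real {ω | p.1 < X q.1 ω ∧ p.2 < Y q.2 ω}) ~[atTop]
        (fun p : ℝ × ℝ => K q * (tail μ (X q.1) p.1 * tail μ (Y q.2) p.2)) := by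
    rintro ⟨i, j⟩ hq
    obtain ⟨hi, hj⟩ := Finset.mem_product.1 hq
    by_cases hij : i = j
    · subst hij
      simpa [hK] using (hSAI i (hdiag i hi hj)).joint
    · have : ∀ p : ℝ × ℝ, μ.real {ω | p.1 < X i ω ∧ p.2 < Y j ω} =
          tail μ (X i) p.1 * tail μ (Y j) p.2 := fun p => by
        have := (hXY i hi j hj hij).measure_inter_preimage_eq_mul _ _
          (measurableSet_Ioi (a := p.1)) (measurableSet_Ioi (a := p.2))
        simp only [tail, Measure.real, ← ENNReal.toReal_mul]
        exact congrArg ENNReal.toReal this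
      simp only [hK, if_neg hij, one_mul, this]
      exact IsEquivalent.refl
  have hKpos : ∀ q ∈ I ×ˢ J, 0 < K q := by
    rintro ⟨i, j⟩ hq
    obtain ⟨hi, hj⟩ := Finset.mem_product.1 hq
    simp only [hK]
    split_ifs with hij
    · subst hij
      exact (hSAI i (hdiag i hi hj)).pos
    · exact one_pos
  have hbounds : ∀ η : ℝ, 0 < η → ∀ q ∈ I ×ˢ J,
      ∀ᶠ ε : ℝ in 𝓝[>] 0, ∀ᶠ p : ℝ × ℝ in atTop,
        μ.real {ω | (1 - ε) * p.1 < U q.1 ω ∧ (1 - ε) * p.2 < V q.2 ω} +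
            interference μ I J U V q ε p ≤
          (1 + η) * (K q * M q * (tail μ (X q.1) p.1 * tail μ (Y q.2) p.2)) ∧
        (1 - η) * (K q * M q * (tail μ (X q.1) p.1 * tail μ (Y q.2) p.2)) ≤
          μ.real {ω | (1 + ε) * p.1 < U q.1 ω ∧ (1 + ε) * p.2 < V q.2 ω} -
            interference μ I J U V q ε p := by
    intro η hη q hq
    obtain ⟨hi, hj⟩ := Finset.mem_product.1 hq
    have hIpos : (0 : ℝ) < (I.card : ℝ)⁻¹ :=
      inv_pos.2 (by exact_mod_cast Finset.card_pos.2 ⟨_, hi⟩)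
    have hJpos : (0 : ℝ) < (J.card : ℝ)⁻¹ :=
      inv_pos.2 (by exact_mod_cast Finset.card_pos.2 ⟨_, hj⟩)
    have hnull : K q * M q = 0 → ∀ᵐ ω ∂μ, ¬ (0 < Θ q.1 ω ∧ 0 < Δ q.2 ω) := fun h =>
      measure_pos_pos_eq_zero (hΘ _ hi) (hΔ _ hj) (hα _ hi) (hα' _ hj)
        ((mul_eq_zero.1 h).resolve_left (hKpos q hq).ne')
    refine eventually_perturbed_bounds (hF _ hi) (hG _ hj) (c := K q * M q)
      (h := fun p => μ.real {ω | p.1 < U q.1 ω ∧ p.2 < V q.2 ω})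
      (mul_nonneg (hKpos q hq).le
        (mixedMoment_nonneg μ (hΘ _ hi).measurable (hΔ _ hj).measurable _ _))
      ?_ ?_ ?_ ?_ hη
    · refine tendsto_weighted_jointTail (hΘ _ hi) (hΔ _ hj) (hX _ hi) (hY _ hj) ?_ (hF _ hi)
        (hG _ hj) (hJoint q hq)
      have hφ : Measurable fun v : (I → ℝ) × (J → ℝ) => (v.1 ⟨q.1, hi⟩, v.2 ⟨q.2, hj⟩) :=
        ((measurable_pi_apply _).comp measurable_fst).prodMk
          ((measurable_pi_apply _).comp measurable_snd)
      exact hindep.comp hφ hφ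
    · intro h
      filter_upwards [eventually_pos_prod] with p hp
      exact measureReal_weighted_eq_zero (hΘ _ hi) (hΔ _ hj) (hnull h) hp.1 hp.2
    · intro ε hε
      have h1 : Tendsto (fun p : ℝ × ℝ => ε * (I.card : ℝ)⁻¹ * p.1) atTop atTop :=
        tendsto_fst_prod_atTop.const_mul_atTop (by positivity)
      have h2 : Tendsto (fun p : ℝ × ℝ => ε * (J.card : ℝ)⁻¹ * p.2) atTop atTop :=
        tendsto_snd_prod_atTop.const_mul_atTop (by positivity)
      simp only [interference, add_div, Finset.sum_div]
      rw [show (0 : ℝ) = ∑ k ∈ I.erase q.1, 0 + ∑ l ∈ J.erase q.2, 0 by simp]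
      refine (tendsto_finsetSum _ fun k hk => ?_).add (tendsto_finsetSum _ fun l hl => ?_)
      · obtain ⟨hne, hk⟩ := Finset.mem_erase.1 hk
        exact tendsto_weighted_triple (hΘ _ hi) (hΔ _ hj) (hΘ _ hk) (hX _ hi) (hY _ hj)
          (hF _ hi) (hG _ hj) (hJoint q hq) (hGTAI.left k hk q.1 hi hne q.2 hj) hIpos hJpos h1
      · obtain ⟨hne, hl⟩ := Finset.mem_erase.1 hl
        exact tendsto_weighted_triple (hΘ _ hi) (hΔ _ hj) (hΔ _ hl) (hX _ hi) (hY _ hj)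
          (hF _ hi) (hG _ hj) (hJoint q hq) (hGTAI.right l hl q.2 hj hne q.1 hi) hIpos hJpos h2
    · intro h ε hε
      filter_upwards [eventually_pos_prod] with p hp
      have h0 := measureReal_weighted_eq_zero (X := X q.1) (Y := Y q.2) (hΘ _ hi) (hΔ _ hj)
        (hnull h) (mul_pos hIpos hp.1) (mul_pos hJpos hp.2)
      have h1 : ∀ S : Ω → Prop, μ.real {ω | ((I.card : ℝ)⁻¹ * p.1 < U q.1 ω ∧
          (J.card : ℝ)⁻¹ * p.2 < V q.2 ω) ∧ S ω} = 0 := fun S =>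
        le_antisymm ((measureReal_mono fun ω hω => hω.1).trans h0.le) measureReal_nonneg
      unfold interference
      simp only [h1, Finset.sum_const_zero, add_zero]
  refine isLittleO_iff.2 fun η hη => ?_
  -- There are finitely many pairs, so one `ε` depending only on `η` serves them all; only then do
  -- the thresholds go to infinity.
  have hall := (Filter.eventually_all_finset (I ×ˢ J)).2 (hbounds η hη)
  obtain ⟨ε, hε, hε0⟩ := (hall.and eventually_mem_nhdsWithin).exists
  filter_upwards [(Filter.eventually_all_finset (I ×ˢ J)).2 hε, eventually_pos_prod] with p h1 hp
  have hup := (measureReal_sums_le (μ := μ) (I := I) (J := J) (U := U) (V := V) hp hε0).trans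
    (Finset.sum_le_sum fun q hq => (h1 q hq).1)
  have hlo := (Finset.sum_le_sum fun q hq => (h1 q hq).2).trans
    (le_measureReal_sums (μ := μ) (I := I) (J := J) (U := U) (V := V)
      (fun i hi => (hΘ i hi).measurable.mul (hX i hi))
      (fun j hj => (hΔ j hj).measurable.mul (hY j hj)) hp hε0)
  rw [← Finset.mul_sum] at hup hlo
  simp only [Pi.sub_apply, Real.norm_eq_abs]
  rw [abs_le]
  have habs := mul_le_mul_of_nonneg_left (le_abs_self
    (∑ q ∈ I ×ˢ J, K q * M q * (tail μ (X q.1) p.1 * tail μ (Y q.2) p.2))) hη.le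
  simp only [hU, hV] at hup hlo
  constructor <;> linarith
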